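/- Let $\alpha\in(0,2)$ and let $m:\mathbb{R}\to[0,\infty)$ be a Borel function with $\int_{\mathbb{R}} m^\alpha(x)\,dx<\infty$. Let $X=\{X(t),\,t\in\mathbb{R}\}$ be a symmetric $\alpha$-stable (S$\alpha$S) moving average with kernel $m$, i.e. $$X(t)=\int_{\mathbb{R}} m(t-x)\,\Lambda(dx),\qquad t\in\mathbb{R},$$ where $\Lambda$ is an S$\alpha$S random measure on $\mathbb{R}$ with Lebesgue control measure: an independently scattered, almost surely $\sigma$-additive random set function on the Borel sets of finite Lebesgue measure with $\mathbb{E}\,e^{is\Lambda(A)}=e^{-|A|\,|s|^\alpha}$, $s\in\mathbb{R}$; the integral is the limit in probability of the integrals of simple functions of finite-measure support converging in $L^\alpha(\mathbb{R})$ to the integrand. If $$\int_{\mathbb{R}}\int_{\mathbb{R}} \min\{m^\alpha(x),m^\alpha(t)\}\,dx\,dt=\infty,$$ then $X$ is long range dependent, that is, $X$ is stationary (its finite-dimensional distributions are invariant under translations) and there exists a finite Borel measure $\mu$ on $\mathbb{R}$ such that $$\int_{\mathbb{R}}\int_{\mathbb{R}}\int_{\mathbb{R}}\bigl|\operatorname{Cov}\bigl(\mathbf{1}\{X(0)>u\},\mathbf{1}\{X(t)>v\}\bigr)\bigr|\,\mu(du)\,\mu(dv)\,dt=\infty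 .$$ -/

import Mathlib

open MeasureTheory ProbabilityTheory Filter Topology

noncomputable section

/-- `Λ` is a symmetric `α`-stable random measure on `ℝ` with Lebesgue control measure, defined on
the Borel sets of finite Lebesgue measure (the values of `Λ` on other sets play no role):
it is an independently scattered, almost surely `σ`-additive random set function such that
`Λ(A)` has characteristic function `s ↦ exp (-|A| |s| ^ α)`. -/
structure IsSaSRandomMeasure {Ω : Type*} [MeasurableSpace Ω] (P : Measure Ω) (α : ℝ)
    (Λ : Set ℝ → Ω → ℝ) : Prop where
  measurable : ∀ A : Set ℝ, MeasurableSet A → volume A < ⊤ → Measurable (Λ A)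
  charFun_eq : ∀ A : Set ℝ, MeasurableSet A → volume A < ⊤ → ∀ s : ℝ,
    charFun (P.map (Λ A)) s = ((Real.exp (-((volume A).toReal * |s| ^ α)) : ℝ) : ℂ)
  indep : ∀ (n : ℕ) (A : Fin n → Set ℝ), (∀ i, MeasurableSet (A i)) → (∀ i, volume (A i) < ⊤) →
    Pairwise (Function.onFun Disjoint A) → iIndepFun (fun i => Λ (A i)) P
  /-- The series converges as a sequence of partial sums; for `α ≥ 1` it need not converge
  absolutely. -/
  sigma_additive : ∀ A : ℕ → Set ℝ, (∀ i, MeasurableSet (A i)) → volume (⋃ i, A i) < ⊤ →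
    Pairwise (Function.onFun Disjoint A) →
    ∀ᵐ ω ∂P, Tendsto (fun n => ∑ i ∈ Finset.range n, Λ (A i) ω) atTop (𝓝 (Λ (⋃ i, A i) ω))

/-- The integral `∫ f dΛ = ∑ c, c Λ(f = c)` of a simple function (used only for simple functions
which vanish outside a set of finite measure). -/
def simpleStableIntegral {Ω : Type*} (Λ : Set ℝ → Ω → ℝ) (f : SimpleFunc ℝ ℝ) : Ω → ℝ :=
  fun ω => ∑ c ∈ f.range, c * Λ (f ⁻¹' {c}) ω

/-- `Y` is (a version of) the stable integral `∫ f dΛ` of `f ∈ L^α(ℝ)`: it is the limit in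
probability of `∫ fₙ dΛ` for simple functions `fₙ`, each vanishing outside a set of finite measure,
which converge to `f` in `L^α(ℝ)`. -/
def IsStableIntegral {Ω : Type*} [MeasurableSpace Ω] (P : Measure Ω) (α : ℝ)
    (Λ : Set ℝ → Ω → ℝ) (f : ℝ → ℝ) (Y : Ω → ℝ) : Prop :=
  ∃ F : ℕ → SimpleFunc ℝ ℝ, (∀ n, (F n).FinMeasSupp volume) ∧
    Tendsto (fun n => eLpNorm (fun x => F n x - f x) (ENNReal.ofReal α) volume) atTop (𝓝 0) ∧
    TendstoInMeasure P (fun n => simpleStableIntegral Λ (F n)) atTop Y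

/-- `X = {X(t), t ∈ ℝ}` is a symmetric `α`-stable moving average with kernel `m ∈ L^α(ℝ)`:
`X(t) = ∫ m(t - x) Λ(dx)` for a symmetric `α`-stable random measure `Λ` with Lebesgue control
measure. -/
structure IsSaSMovingAverage {Ω : Type*} [MeasurableSpace Ω] (P : Measure Ω) (α : ℝ)
    (m : ℝ → ℝ) (X : ℝ → Ω → ℝ) : Prop where
  measurable_kernel : Measurable m
  memLp_kernel : MemLp m (ENNReal.ofReal α) volume
  measurable : ∀ t, Measurable (X t)
  exists_integral : ∃ Λ : Set ℝ → Ω → ℝ, IsSaSRandomMeasure P α Λ ∧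
    ∀ t : ℝ, IsStableIntegral P α Λ (fun x => m (t - x)) (X t)

/-- All finite-dimensional distributions of `X` are invariant under translations. -/
def IsStationaryProcess {Ω : Type*} [MeasurableSpace Ω] (P : Measure Ω) (X : ℝ → Ω → ℝ) : Prop :=
  ∀ (n : ℕ) (t : Fin n → ℝ) (h : ℝ),
    IdentDistrib (fun ω i => X (t i + h) ω) (fun ω i => X (t i) ω) P P

/-- `Cov(𝟙{X(0) > u}, 𝟙{X(t) > v})`. -/
def excursionCov {Ω : Type*} [MeasurableSpace Ω] (P : Measure Ω) (X : ℝ → Ω → ℝ)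
    (t u v : ℝ) : ℝ :=
  covariance ({ω | u < X 0 ω}.indicator (fun _ => (1 : ℝ)))
    ({ω | v < X t ω}.indicator (fun _ => (1 : ℝ))) P

/-- `X` is a stationary process for which there is a finite Borel measure `μ` on `ℝ` with
`∫_ℝ ∫_ℝ ∫_ℝ |Cov(𝟙{X(0) > u}, 𝟙{X(t) > v})| μ(du) μ(dv) dt = ∞`. -/
def IsLongRangeDependent {Ω : Type*} [MeasurableSpace Ω] (P : Measure Ω)
    (X : ℝ → Ω → ℝ) : Prop :=
  IsStationaryProcess P X ∧
    ∃ μ : Measure ℝ, IsFiniteMeasure μ ∧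
      ∫⁻ t : ℝ, ∫⁻ v : ℝ, ∫⁻ u : ℝ, ENNReal.ofReal |excursionCov P X t u v| ∂μ ∂μ = ⊤

end

/-! Take `μ` with density `1 / (1 + u ^ 2)` and put `h x = 1 / (1 + x ^ 2)`. This `h` is at once a
mixture of excursion indicators, `h x = ∫ w u * 1{u < x} μ(du)` with `|w| ≤ 1`
(`integral_cauchyDensityMeasure`), and a mixture of cosines with positive weights `exp (-s) ds` on
`(0, ∞)` (`integral_expDensityMeasure_cos`). Since covariances of mixtures are mixtures of
covariances, the first form bounds `Cov(h(X 0), h(X t))` by the `μ ⊗ μ` integral of the absolute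
excursion covariances, and the second writes it through `Cov(cos(u X 0), cos(v X t))`.

The cosine covariances are explicit: for stable integrals `Y`, `Z` of `f`, `g` they involve only the
integrals of `|f ± g| ^ α`, `|f| ^ α` and `|g| ^ α`. A pointwise inequality, strict enough because
`α < 2`, makes them nonnegative and bounds them below by a multiple of the integral of `min (|f| ^
α) (|g| ^ α)` (`le_covariance_cos`). For `u, v ∈ [1, 2]` the multiple is uniform in `t`, and
integrating over `t` yields the divergent double integral of the hypothesis.

Stationarity follows from the same characteristic function formula and translation invariance of
Lebesgue measure. -/

section StableIntegral

variable {Ω : Type*} [MeasurableSpace Ω] {P : Measure Ω} {α : ℝ} {Λ : Set ℝ → Ω → ℝ}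

/-! ### Integrals of simple functions: linearity and characteristic function -/

namespace IsSaSRandomMeasure

/-- The series all of whose terms are `Λ ∅` converges almost surely, so its terms tend to zero. -/
lemma ae_empty (hΛ : IsSaSRandomMeasure P α Λ) : ∀ᵐ ω ∂P, Λ ∅ ω = 0 := by
  have h := hΛ.sigma_additive (fun _ => ∅) (fun _ => MeasurableSet.empty) (by simp)
    (fun i j _ => by simp [Function.onFun])
  filter_upwards [h] with ω hω
  have h2 := (tendsto_add_atTop_iff_nat 1).2 hω
  simp only [Finset.sum_range_succ, Set.iUnion_empty] at h2 hω
  have h3 := h2.sub hω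
  simpa using h3

lemma ae_union (hΛ : IsSaSRandomMeasure P α Λ) {A B : Set ℝ} (hA : MeasurableSet A)
    (hB : MeasurableSet B) (hAB : Disjoint A B) (hfin : volume (A ∪ B) < ⊤) :
    ∀ᵐ ω ∂P, Λ (A ∪ B) ω = Λ A ω + Λ B ω := by
  let C : ℕ → Set ℝ := fun n => if n = 0 then A else if n = 1 then B else ∅
  have hU : (⋃ i, C i) = A ∪ B := by
    ext x
    simp only [Set.mem_iUnion, Set.mem_union]
    constructor
    · rintro ⟨i, hi⟩
      simp only [C] at hi
      split_ifs at hi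
      · exact Or.inl hi
      · exact Or.inr hi
      · simp at hi
    · rintro (h | h)
      · exact ⟨0, by simpa [C] using h⟩
      · exact ⟨1, by simpa [C] using h⟩
  have h := hΛ.sigma_additive C
    (fun i => by simp only [C]; split_ifs <;> simp [hA, hB]) (by rwa [hU])
    (fun i j hij => by
      simp only [Function.onFun, C]
      split_ifs <;> simp_all [disjoint_comm])
  filter_upwards [h, hΛ.ae_empty] with ω hω h0
  rw [hU] at hω
  -- The partial sums are constant from index 2 on, every later term being `Λ ∅ = 0`.
  refine tendsto_nhds_unique hω (tendsto_atTop_of_eventually_const (i₀ := 2) fun n hn => ?_)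
  obtain ⟨k, rfl⟩ := Nat.exists_eq_add_of_le hn
  clear hn
  induction k with
  | zero => simp [Finset.sum_range_succ, C]
  | succ k ih =>
    have hk : 2 + k ≠ 1 := by omega
    rw [← add_assoc, Finset.sum_range_succ, ih]
    simp [C, h0, hk]

lemma ae_preimage_finset (hΛ : IsSaSRandomMeasure P α Λ) {β : Type*}
    (G : SimpleFunc ℝ β) (S : Finset β) (hS : volume (G ⁻¹' (S : Set β)) < ⊤) :
    ∀ᵐ ω ∂P, Λ (G ⁻¹' (S : Set β)) ω = ∑ b ∈ S, Λ (G ⁻¹' {b}) ω := by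
  classical
  induction S using Finset.induction_on with
  | empty => simpa using hΛ.ae_empty
  | insert a S ha ih =>
    have hU : G ⁻¹' ((insert a S : Finset β) : Set β) = G ⁻¹' {a} ∪ G ⁻¹' (S : Set β) := by
      ext x; simp
    rw [hU] at hS
    have h1 := ih ((measure_mono Set.subset_union_right).trans_lt hS)
    have h2 := hΛ.ae_union (G.measurableSet_preimage _) (G.measurableSet_preimage _)
      (Disjoint.preimage _ (by simpa using ha)) hS
    filter_upwards [h1, h2] with ω e1 e2
    rw [hU, e2, e1, Finset.sum_insert ha]

/-- The integral may be computed on any finer partition. Applied to `SimpleFunc.pair F G`, this puts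
two simple functions on a common partition, which gives additivity. -/
lemma ae_simpleStableIntegral_map (hΛ : IsSaSRandomMeasure P α Λ) {β : Type*}
    (G : SimpleFunc ℝ β) (φ : β → ℝ) (hG : (G.map φ).FinMeasSupp volume) :
    ∀ᵐ ω ∂P, simpleStableIntegral Λ (G.map φ) ω =
      ∑ b ∈ G.range, φ b * Λ (G ⁻¹' {b}) ω := by
  classical
  have h : ∀ c : ℝ, ∀ᵐ ω ∂P, c * Λ (G.map φ ⁻¹' {c}) ω =
      c * ∑ b ∈ G.range with φ b = c, Λ (G ⁻¹' {b}) ω := by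
    intro c
    -- The zero fibre may have infinite measure, where nothing is known about `Λ`, but its weight is
    -- zero.
    rcases eq_or_ne c 0 with rfl | hc
    · simp
    · have h0 := hG.meas_preimage_singleton_ne_zero hc
      rw [SimpleFunc.map_preimage_singleton] at h0 ⊢
      filter_upwards [hΛ.ae_preimage_finset G _ h0] with ω e
      rw [e]
  have h' := (ae_ball_iff (G.map φ).range.countable_toSet).2 fun c _ => h c
  filter_upwards [h'] with ω e
  rw [simpleStableIntegral, Finset.sum_congr rfl e, SimpleFunc.range_map,
    ← Finset.sum_fiberwise_of_maps_to (g := φ) (t := G.range.image φ)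
      (fun b hb => Finset.mem_image_of_mem φ hb)]
  refine Finset.sum_congr rfl fun c _ => ?_
  rw [Finset.mul_sum]
  refine Finset.sum_congr rfl fun b hb => ?_
  rw [(Finset.mem_filter.1 hb).2]

lemma ae_simpleStableIntegral_add (hΛ : IsSaSRandomMeasure P α Λ) {F G : SimpleFunc ℝ ℝ}
    (hF : F.FinMeasSupp volume) (hG : G.FinMeasSupp volume) :
    ∀ᵐ ω ∂P, simpleStableIntegral Λ (F + G) ω =
      simpleStableIntegral Λ F ω + simpleStableIntegral Λ G ω := by
  have h1 := hΛ.ae_simpleStableIntegral_map (SimpleFunc.pair F G) Prod.fst hF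
  have h2 := hΛ.ae_simpleStableIntegral_map (SimpleFunc.pair F G) Prod.snd hG
  have h3 := hΛ.ae_simpleStableIntegral_map (SimpleFunc.pair F G) (fun p => p.1 + p.2) (hF.add hG)
  filter_upwards [h1, h2, h3] with ω e1 e2 e3
  change simpleStableIntegral Λ F ω = _ at e1
  change simpleStableIntegral Λ G ω = _ at e2
  change simpleStableIntegral Λ (F + G) ω = _ at e3
  rw [e1, e2, e3, ← Finset.sum_add_distrib]
  exact Finset.sum_congr rfl fun b _ => add_mul _ _ _

lemma ae_simpleStableIntegral_const_mul (hΛ : IsSaSRandomMeasure P α Λ) {F : SimpleFunc ℝ ℝ}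
    (hF : F.FinMeasSupp volume) (c : ℝ) :
    ∀ᵐ ω ∂P, simpleStableIntegral Λ (F.map (c * ·)) ω = c * simpleStableIntegral Λ F ω := by
  filter_upwards [hΛ.ae_simpleStableIntegral_map F (c * ·) (hF.map (mul_zero c))] with ω e
  rw [e, simpleStableIntegral, Finset.mul_sum]
  exact Finset.sum_congr rfl fun b _ => mul_assoc _ _ _

lemma measurable_simpleStableIntegral (hΛ : IsSaSRandomMeasure P α Λ) {F : SimpleFunc ℝ ℝ}
    (hF : F.FinMeasSupp volume) : Measurable (simpleStableIntegral Λ F) := by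
  refine Finset.measurable_sum _ fun c _ => ?_
  rcases eq_or_ne c 0 with rfl | hc
  · simp
  · exact (hΛ.measurable _ (F.measurableSet_preimage _)
      (hF.meas_preimage_singleton_ne_zero hc)).const_mul c

lemma charFun_simpleStableIntegral [IsProbabilityMeasure P] (hΛ : IsSaSRandomMeasure P α Λ)
    (hα : 0 < α) {F : SimpleFunc ℝ ℝ} (hF : F.FinMeasSupp volume) :
    charFun (P.map (simpleStableIntegral Λ F)) 1 =
      ((Real.exp (-(∫⁻ x, ‖F x‖ₑ ^ α).toReal) : ℝ) : ℂ) := by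
  classical
  set S : Finset ℝ := F.range.filter (· ≠ 0) with hSdef
  have hS0 : ∀ c : S, (c : ℝ) ≠ 0 := fun c => (Finset.mem_filter.1 c.2).2
  have hI : simpleStableIntegral Λ F = fun ω => ∑ c : S, (c : ℝ) * Λ (F ⁻¹' {(c : ℝ)}) ω := by
    ext ω
    rw [Finset.sum_coe_sort S (fun c => c * Λ (F ⁻¹' {c}) ω), simpleStableIntegral, hSdef,
      Finset.sum_filter_of_ne]
    rintro x - hx rfl
    simp at hx
  have hmeas : ∀ c : S, MeasurableSet (F ⁻¹' {(c : ℝ)}) := fun c => F.measurableSet_preimage _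
  have hfin : ∀ c : S, volume (F ⁻¹' {(c : ℝ)}) < ⊤ := fun c =>
    hF.meas_preimage_singleton_ne_zero (hS0 c)
  have hind : iIndepFun (fun c : S => Λ (F ⁻¹' {(c : ℝ)})) P := by
    let e := Fintype.equivFin S
    have := hΛ.indep _ (fun i => F ⁻¹' {((e.symm i : S) : ℝ)}) (fun i => hmeas _)
      (fun i => hfin _) (fun i j hij => by
        refine Disjoint.preimage _ ?_
        simpa [Subtype.val_inj] using hij)
    simpa using this.precomp e.injective
  have hind2 : iIndepFun (fun c : S => fun ω => (c : ℝ) * Λ (F ⁻¹' {(c : ℝ)}) ω) P :=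
    hind.comp (fun c x => (c : ℝ) * x) fun c => by fun_prop
  have hJ : (∫⁻ x, ‖F x‖ₑ ^ α) = ∑ c ∈ S, ‖c‖ₑ ^ α * volume (F ⁻¹' {c}) := by
    have h1 : (∫⁻ x, ‖F x‖ₑ ^ α) = ∫⁻ x, (F.map (fun y => ‖y‖ₑ ^ α)) x := rfl
    rw [h1, SimpleFunc.lintegral_eq_lintegral, SimpleFunc.map_lintegral, hSdef,
      Finset.sum_filter_of_ne]
    rintro x - hx rfl
    simp [hα] at hx
  rw [hI, hind2.charFun_map_fun_sum_eq_prod (fun c =>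
    ((hΛ.measurable _ (hmeas c) (hfin c)).const_mul _).aemeasurable), hJ, Finset.prod_apply,
    ENNReal.toReal_sum]
  · rw [← Finset.sum_coe_sort S, ← Finset.sum_neg_distrib, Real.exp_sum, Complex.ofReal_prod]
    refine Finset.prod_congr rfl fun c _ => ?_
    rw [charFun_map_mul_comp (hΛ.measurable _ (hmeas c) (hfin c)).aemeasurable,
      hΛ.charFun_eq _ (hmeas c) (hfin c), mul_one, ENNReal.toReal_mul, mul_comm,
      ← ENNReal.toReal_rpow, toReal_enorm, Real.norm_eq_abs]
  · intro c hc
    exact ENNReal.mul_ne_top (ENNReal.rpow_ne_top_of_nonneg hα.le (by simp)) (hfin ⟨c, hc⟩).ne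

end IsSaSRandomMeasure

end StableIntegral

/-! ### Stable integrals as limits, and stationarity -/

section StableIntegralLimit

variable {Ω : Type*} [MeasurableSpace Ω] {P : Measure Ω} {α : ℝ} {Λ : Set ℝ → Ω → ℝ}

lemma tendsto_eLpNorm_add_zero {p : ENNReal} {F G : ℕ → ℝ → ℝ}
    (hFm : ∀ n, AEStronglyMeasurable (F n) volume) (hGm : ∀ n, AEStronglyMeasurable (G n) volume)
    (hF : Tendsto (fun n => eLpNorm (F n) p volume) atTop (𝓝 0))
    (hG : Tendsto (fun n => eLpNorm (G n) p volume) atTop (𝓝 0)) :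
    Tendsto (fun n => eLpNorm (F n + G n) p volume) atTop (𝓝 0) := by
  have h : Tendsto (fun n => ENNReal.LpAddConst p * (eLpNorm (F n) p volume + eLpNorm (G n) p volume))
      atTop (𝓝 (ENNReal.LpAddConst p * (0 + 0))) :=
    ENNReal.Tendsto.const_mul (hF.add hG) (Or.inr (ENNReal.LpAddConst_lt_top p).ne)
  rw [add_zero, mul_zero] at h
  exact tendsto_of_tendsto_of_tendsto_of_le_of_le tendsto_const_nhds h (fun _ => zero_le)
    fun n => eLpNorm_add_le' (hFm n) (hGm n) p

lemma eLpNorm_ofReal_eq (hα : 0 < α) (f : ℝ → ℝ) :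
    eLpNorm f (ENNReal.ofReal α) volume = (∫⁻ x, ‖f x‖ₑ ^ α) ^ (1 / α) := by
  rw [eLpNorm_eq_lintegral_rpow_enorm_toReal (by simpa using hα) ENNReal.ofReal_ne_top,
    ENNReal.toReal_ofReal hα.le]

lemma lintegral_rpow_eq_eLpNorm_rpow (hα : 0 < α) (f : ℝ → ℝ) :
    ∫⁻ x, ‖f x‖ₑ ^ α = eLpNorm f (ENNReal.ofReal α) volume ^ α := by
  rw [eLpNorm_ofReal_eq hα, ← ENNReal.rpow_mul, one_div, inv_mul_cancel₀ hα.ne', ENNReal.rpow_one]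

lemma tendsto_of_le_add_of_le_add {a e : ℕ → ENNReal} {b : ENNReal} (hb : b ≠ ⊤)
    (he : Tendsto e atTop (𝓝 0)) (h1 : ∀ n, a n ≤ e n + b) (h2 : ∀ n, b ≤ e n + a n) :
    Tendsto a atTop (𝓝 b) := by
  have u : Tendsto (fun n => e n + b) atTop (𝓝 b) := by simpa using he.add_const b
  have l : Tendsto (fun n => b - e n) atTop (𝓝 b) := by
    simpa using ENNReal.Tendsto.sub (tendsto_const_nhds (x := b)) he (Or.inl hb)
  exact tendsto_of_tendsto_of_tendsto_of_le_of_le l u (fun n => tsub_le_iff_left.2 (h2 n)) h1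

/-- For `α ≥ 1` this is the triangle inequality for the norm. For `α ≤ 1` that fails, and
subadditivity of `y ↦ y ^ α` is integrated instead. -/
lemma tendsto_lintegral_rpow_of_eLpNorm_sub (hα : 0 < α) {F : ℕ → ℝ → ℝ} {f : ℝ → ℝ}
    (hFm : ∀ n, Measurable (F n)) (hf : Measurable f)
    (hfp : MemLp f (ENNReal.ofReal α) volume)
    (h : Tendsto (fun n => eLpNorm (fun x => F n x - f x) (ENNReal.ofReal α) volume) atTop (𝓝 0)) :
    Tendsto (fun n => ∫⁻ x, ‖F n x‖ₑ ^ α) atTop (𝓝 (∫⁻ x, ‖f x‖ₑ ^ α)) := by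
  rcases le_total 1 α with h1 | h1
  · simp_rw [lintegral_rpow_eq_eLpNorm_rpow hα]
    refine (ENNReal.continuous_rpow_const.tendsto _).comp ?_
    have hp : 1 ≤ ENNReal.ofReal α := by simpa using h1
    refine tendsto_of_le_add_of_le_add hfp.2.ne h (fun n => ?_) fun n => ?_
    · have := eLpNorm_add_le (μ := volume) (p := ENNReal.ofReal α)
        ((hFm n).sub hf).aestronglyMeasurable hf.aestronglyMeasurable hp
      rwa [sub_add_cancel] at this
    · have := eLpNorm_add_le (μ := volume) (p := ENNReal.ofReal α)
        (hf.sub (hFm n)).aestronglyMeasurable (hFm n).aestronglyMeasurable hp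
      rwa [sub_add_cancel, eLpNorm_sub_comm] at this
  · have he : Tendsto (fun n => ∫⁻ x, ‖F n x - f x‖ₑ ^ α) atTop (𝓝 0) := by
      simp_rw [fun n => lintegral_rpow_eq_eLpNorm_rpow hα (fun x => F n x - f x)]
      have := (ENNReal.continuous_rpow_const (y := α)).tendsto 0
      rw [ENNReal.zero_rpow_of_pos hα] at this
      exact this.comp h
    have hJ : ∫⁻ x, ‖f x‖ₑ ^ α ≠ ⊤ := by
      rw [lintegral_rpow_eq_eLpNorm_rpow hα]
      exact ENNReal.rpow_ne_top_of_nonneg hα.le hfp.2.ne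
    have key : ∀ a b : ℝ, ‖a‖ₑ ^ α ≤ ‖a - b‖ₑ ^ α + ‖b‖ₑ ^ α := fun a b => by
      refine le_trans (ENNReal.rpow_le_rpow ?_ hα.le)
        (ENNReal.rpow_add_le_add_rpow _ _ hα.le h1)
      simpa using enorm_add_le (a - b) b
    refine tendsto_of_le_add_of_le_add hJ he (fun n => ?_) fun n => ?_
    · rw [← lintegral_add_left (by fun_prop)]
      exact lintegral_mono fun x => key _ _
    · rw [← lintegral_add_left (by fun_prop)]
      refine lintegral_mono fun x => ?_
      have := key (f x) (F n x)
      rwa [← enorm_neg (f x - F n x), neg_sub] at this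

/-- `Y` is an almost sure limit of integrals of simple functions converging to `f` in `L^α`. -/
def IsAEStableIntegral (P : Measure Ω) (α : ℝ) (Λ : Set ℝ → Ω → ℝ) (f : ℝ → ℝ) (Y : Ω → ℝ) :
    Prop :=
  ∃ F : ℕ → SimpleFunc ℝ ℝ, (∀ n, (F n).FinMeasSupp volume) ∧
    Tendsto (fun n => eLpNorm (fun x => F n x - f x) (ENNReal.ofReal α) volume) atTop (𝓝 0) ∧
    ∀ᵐ ω ∂P, Tendsto (fun n => simpleStableIntegral Λ (F n) ω) atTop (𝓝 (Y ω))

/-- A subsequence converges almost surely, so linearity and dominated convergence can be applied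
pointwise in `ω`. -/
lemma IsStableIntegral.isAEStableIntegral {f : ℝ → ℝ} {Y : Ω → ℝ}
    (h : IsStableIntegral P α Λ f Y) : IsAEStableIntegral P α Λ f Y := by
  obtain ⟨F, hF, hL, hY⟩ := h
  obtain ⟨ns, hns, hae⟩ := hY.exists_seq_tendsto_ae
  exact ⟨F ∘ ns, fun n => hF _, hL.comp hns.tendsto_atTop, hae⟩

namespace IsAEStableIntegral

lemma add (hΛ : IsSaSRandomMeasure P α Λ) {f g : ℝ → ℝ} {Y Z : Ω → ℝ}
    (hf : Measurable f) (hg : Measurable g)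
    (hY : IsAEStableIntegral P α Λ f Y) (hZ : IsAEStableIntegral P α Λ g Z) :
    IsAEStableIntegral P α Λ (fun x => f x + g x) (fun ω => Y ω + Z ω) := by
  obtain ⟨F, hF, hFL, hFY⟩ := hY
  obtain ⟨G, hG, hGL, hGZ⟩ := hZ
  refine ⟨fun n => F n + G n, fun n => (hF n).add (hG n), ?_, ?_⟩
  · have := tendsto_eLpNorm_add_zero
      (fun n => ((F n).measurable.sub hf).aestronglyMeasurable)
      (fun n => ((G n).measurable.sub hg).aestronglyMeasurable) hFL hGL
    refine this.congr fun n => ?_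
    congr 1
    ext x
    simp only [Pi.add_apply, Pi.sub_apply, SimpleFunc.coe_add]
    ring
  · have := ae_all_iff.2 fun n => hΛ.ae_simpleStableIntegral_add (hF n) (hG n)
    filter_upwards [hFY, hGZ, this] with ω h1 h2 h3
    exact (h1.add h2).congr fun n => (h3 n).symm

lemma const_mul (hΛ : IsSaSRandomMeasure P α Λ) {f : ℝ → ℝ} {Y : Ω → ℝ}
    (hY : IsAEStableIntegral P α Λ f Y) (c : ℝ) :
    IsAEStableIntegral P α Λ (fun x => c * f x) (fun ω => c * Y ω) := by
  obtain ⟨F, hF, hFL, hFY⟩ := hY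
  refine ⟨fun n => (F n).map (c * ·), fun n => (hF n).map (mul_zero c), ?_, ?_⟩
  · have : Tendsto (fun n => ‖c‖ₑ * eLpNorm (fun x => F n x - f x) (ENNReal.ofReal α) volume)
        atTop (𝓝 (‖c‖ₑ * 0)) := ENNReal.Tendsto.const_mul hFL (Or.inr (by simp))
    rw [mul_zero] at this
    refine this.congr fun n => ?_
    rw [← eLpNorm_const_smul]
    congr 1
    ext x
    simp [mul_sub]
  · have := ae_all_iff.2 fun n => hΛ.ae_simpleStableIntegral_const_mul (hF n) c
    filter_upwards [hFY, this] with ω h1 h3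
    exact (h1.const_mul c).congr fun n => (h3 n).symm

lemma zero : IsAEStableIntegral P α Λ (fun _ => 0) (fun _ => 0) := by
  classical
  refine ⟨fun _ => 0, fun n => SimpleFunc.finMeasSupp_iff_support.2 (by simp), ?_, ?_⟩
  · simp
  · refine Eventually.of_forall fun ω => ?_
    have : simpleStableIntegral Λ 0 ω = 0 := by simp [simpleStableIntegral]
    simp [this]

lemma sum (hΛ : IsSaSRandomMeasure P α Λ) {ι : Type*} (s : Finset ι) {f : ι → ℝ → ℝ}
    {Y : ι → Ω → ℝ} (hf : ∀ i, Measurable (f i)) (hY : ∀ i, IsAEStableIntegral P α Λ (f i) (Y i)) :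
    IsAEStableIntegral P α Λ (fun x => ∑ i ∈ s, f i x) (fun ω => ∑ i ∈ s, Y i ω) := by
  classical
  induction s using Finset.induction_on with
  | empty => simpa using zero
  | insert a s ha ih =>
    simp_rw [Finset.sum_insert ha]
    exact add hΛ (hf a) (Finset.measurable_sum s fun i _ => hf i) (hY a) ih

/-- Dominated convergence carries the formula over from simple functions. Frequency one suffices, as
other frequencies are absorbed into `f`. -/
lemma integral_cexp [IsProbabilityMeasure P] (hα : 0 < α) (hΛ : IsSaSRandomMeasure P α Λ)
    {f : ℝ → ℝ} {Y : Ω → ℝ} (hf : Measurable f) (hfp : MemLp f (ENNReal.ofReal α) volume)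
    (hY : IsAEStableIntegral P α Λ f Y) :
    ∫ ω, Complex.exp (Y ω * Complex.I) ∂P =
      ((Real.exp (-(∫⁻ x, ‖f x‖ₑ ^ α).toReal) : ℝ) : ℂ) := by
  obtain ⟨F, hF, hL, hae⟩ := hY
  have hJ : ∫⁻ x, ‖f x‖ₑ ^ α ≠ ⊤ := by
    rw [lintegral_rpow_eq_eLpNorm_rpow hα]
    exact ENNReal.rpow_ne_top_of_nonneg hα.le hfp.2.ne
  have hm := fun n => hΛ.measurable_simpleStableIntegral (hF n)
  have h1 : Tendsto (fun n => ∫ ω, Complex.exp (simpleStableIntegral Λ (F n) ω * Complex.I) ∂P)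
      atTop (𝓝 (∫ ω, Complex.exp (Y ω * Complex.I) ∂P)) := by
    refine tendsto_integral_of_dominated_convergence (fun _ => 1) (fun n => ?_)
      (integrable_const 1) (fun n => ?_) ?_
    · have := hm n
      exact Measurable.aestronglyMeasurable (by fun_prop)
    · exact Eventually.of_forall fun ω => by rw [Complex.norm_exp_ofReal_mul_I]
    · filter_upwards [hae] with ω h
      have hc : Continuous fun y : ℝ => Complex.exp (y * Complex.I) := by fun_prop
      exact (hc.tendsto _).comp h
  have h2 : Tendsto (fun n => ((Real.exp (-(∫⁻ x, ‖F n x‖ₑ ^ α).toReal) : ℝ) : ℂ)) atTop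
      (𝓝 ((Real.exp (-(∫⁻ x, ‖f x‖ₑ ^ α).toReal) : ℝ) : ℂ)) := by
    have hc : Continuous fun y : ℝ => ((Real.exp (-y) : ℝ) : ℂ) := by fun_prop
    exact (hc.tendsto _).comp ((ENNReal.tendsto_toReal hJ).comp
      (tendsto_lintegral_rpow_of_eLpNorm_sub hα (fun n => (F n).measurable) hf hfp hL))
  refine tendsto_nhds_unique h1 (h2.congr fun n => ?_)
  rw [← hΛ.charFun_simpleStableIntegral hα (hF n), charFun_apply_real,
    integral_map (hm n).aemeasurable (Measurable.aestronglyMeasurable (by fun_prop))]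
  simp

lemma integral_cos [IsProbabilityMeasure P] (hα : 0 < α) (hΛ : IsSaSRandomMeasure P α Λ)
    {f : ℝ → ℝ} {Y : Ω → ℝ} (hf : Measurable f) (hfp : MemLp f (ENNReal.ofReal α) volume)
    (hYm : Measurable Y) (hY : IsAEStableIntegral P α Λ f Y) :
    ∫ ω, Real.cos (Y ω) ∂P = Real.exp (-(∫⁻ x, ‖f x‖ₑ ^ α).toReal) := by
  have h := congrArg Complex.re (hY.integral_cexp hα hΛ hf hfp)
  rw [Complex.ofReal_re, ← RCLike.re_eq_complex_re, ← integral_re] at h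
  · rw [← h]
    refine integral_congr_ae (Eventually.of_forall fun ω => ?_)
    simp only [RCLike.re_eq_complex_re, Complex.exp_ofReal_mul_I_re]
  · refine Integrable.of_bound (C := 1) (Measurable.aestronglyMeasurable (by fun_prop)) ?_
    exact Eventually.of_forall fun ω => by rw [Complex.norm_exp_ofReal_mul_I]

end IsAEStableIntegral

/-- A linear combination of the `X (t i)` is the stable integral of the same combination of shifted
kernels, so the joint characteristic function sees only an integral that is invariant under shifting
all `t i`. -/
lemma IsSaSMovingAverage.isStationaryProcess [IsProbabilityMeasure P] (hα : 0 < α)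
    {m : ℝ → ℝ} {X : ℝ → Ω → ℝ} (hX : IsSaSMovingAverage P α m X) :
    IsStationaryProcess P X := by
  intro n t h
  obtain ⟨Λ, hΛ, hI⟩ := hX.exists_integral
  have hXm := hX.measurable
  have hmm := hX.measurable_kernel
  have hchar : ∀ (t : Fin n → ℝ) (L : StrongDual ℝ (Fin n → ℝ)),
      charFunDual (P.map (fun ω i => X (t i) ω)) L =
      ((Real.exp (-(∫⁻ x, ‖∑ i, L (Pi.single i 1) * m (t i - x)‖ₑ ^ α).toReal) : ℝ) : ℂ) := by
    intro t L
    have hS : IsAEStableIntegral P α Λ (fun x => ∑ i, L (Pi.single i 1) * m (t i - x))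
        (fun ω => ∑ i, L (Pi.single i 1) * X (t i) ω) :=
      IsAEStableIntegral.sum hΛ _ (fun i => by fun_prop)
        fun i => (hI (t i)).isAEStableIntegral.const_mul hΛ _
    rw [← hS.integral_cexp hα hΛ (by fun_prop), charFunDual_apply,
      integral_map (by fun_prop) (Measurable.aestronglyMeasurable (by fun_prop))]
    · refine integral_congr_ae (Eventually.of_forall fun ω => ?_)
      have : L (fun i => X (t i) ω) = ∑ i, L (Pi.single i 1) * X (t i) ω := by
        conv_lhs => rw [← LinearMap.sum_single_apply (φ := fun _ => ℝ) (fun i => X (t i) ω)]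
        rw [map_sum]
        refine Finset.sum_congr rfl fun i _ => ?_
        have e : (Pi.single i (X (t i) ω) : Fin n → ℝ) = X (t i) ω • Pi.single i 1 := by
          rw [← Pi.single_smul]; simp
        rw [e, map_smul, smul_eq_mul, mul_comm]
      simp only [this]
    · refine memLp_finsetSum _ fun i _ => ?_
      exact (hX.memLp_kernel.comp_measurePreserving
        (Measure.measurePreserving_sub_left volume (t i))).const_mul _
  refine ⟨by fun_prop, by fun_prop, ?_⟩
  have : IsProbabilityMeasure (P.map (fun ω i => X (t i) ω)) :=
    Measure.isProbabilityMeasure_map (by fun_prop)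
  have : IsProbabilityMeasure (P.map (fun ω i => X (t i + h) ω)) :=
    Measure.isProbabilityMeasure_map (by fun_prop)
  refine Measure.ext_of_charFunDual (funext fun L => ?_)
  rw [hchar, hchar]
  congr 4
  rw [← lintegral_add_right_eq_self _ h]
  simp

end StableIntegralLimit

/-- Let `|b| ≤ |a|` and write `|x| ^ α = (x ^ 2) ^ (α / 2)`. Concavity bounds the first two terms by
`2 * (a ^ 2 + b ^ 2) ^ (α / 2)`, and Bernoulli's inequality bounds this by `2 * |a| ^ α + α * |b| ^
α`, leaving room for `(2 - α) * |b| ^ α`. -/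
lemma rpow_abs_add_add_rpow_abs_sub_le {α : ℝ} (hα0 : 0 < α) (hα2 : α < 2) (a b : ℝ) :
    |a + b| ^ α + |a - b| ^ α + (2 - α) * min (|a| ^ α) (|b| ^ α) ≤
      2 * (|a| ^ α + |b| ^ α) := by
  wlog hab : |b| ≤ |a| generalizing a b
  · have := this b a (le_of_not_ge hab)
    rwa [add_comm b a, abs_sub_comm b a, min_comm, add_comm (|b| ^ α)] at this
  have hsq : ∀ x : ℝ, |x| ^ α = (x ^ 2) ^ (α / 2) := fun x => by
    rw [← sq_abs, ← Real.rpow_natCast, ← Real.rpow_mul (abs_nonneg x)]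
    congr 1
    push_cast
    ring
  have hβ0 : 0 < α / 2 := by linarith
  have hβ1 : α / 2 ≤ 1 := by linarith
  rw [min_eq_right (Real.rpow_le_rpow (abs_nonneg b) hab hα0.le)]
  have h1 : ((a + b) ^ 2) ^ (α / 2) + ((a - b) ^ 2) ^ (α / 2) ≤ 2 * (a ^ 2 + b ^ 2) ^ (α / 2) := by
    have hc := (Real.concaveOn_rpow hβ0.le hβ1).2 (sq_nonneg (a + b)) (sq_nonneg (a - b))
      (show (0 : ℝ) ≤ 1 / 2 by norm_num) (show (0 : ℝ) ≤ 1 / 2 by norm_num) (by norm_num)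
    have e : (1 / 2 : ℝ) * (a + b) ^ 2 + 1 / 2 * (a - b) ^ 2 = a ^ 2 + b ^ 2 := by ring
    simp only [smul_eq_mul, e] at hc
    linarith
  have h2 : (a ^ 2 + b ^ 2) ^ (α / 2) ≤ (a ^ 2) ^ (α / 2) + α / 2 * (b ^ 2) ^ (α / 2) := by
    rcases eq_or_ne a 0 with rfl | ha
    · have hb : b = 0 := by simpa using hab
      simp [hb, Real.zero_rpow hβ0.ne']
    · have ha2 : 0 < a ^ 2 := by positivity
      have hr1 : b ^ 2 / a ^ 2 ≤ 1 := (div_le_one ha2).2 (sq_le_sq.2 hab)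
      have hr0 : 0 ≤ b ^ 2 / a ^ 2 := by positivity
      have e1 : a ^ 2 + b ^ 2 = a ^ 2 * (1 + b ^ 2 / a ^ 2) := by field_simp
      have e2 : (b ^ 2) ^ (α / 2) = (a ^ 2) ^ (α / 2) * (b ^ 2 / a ^ 2) ^ (α / 2) := by
        rw [← Real.mul_rpow ha2.le hr0]
        congr 1
        field_simp
      have h3 := rpow_one_add_le_one_add_mul_self (s := b ^ 2 / a ^ 2) (by linarith) hβ0.le hβ1
      have h4 : b ^ 2 / a ^ 2 ≤ (b ^ 2 / a ^ 2) ^ (α / 2) := by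
        rcases hr0.eq_or_lt with h | h
        · rw [← h, Real.zero_rpow hβ0.ne']
        · simpa using Real.rpow_le_rpow_of_exponent_ge h hr1 hβ1
      rw [e1, Real.mul_rpow ha2.le (by linarith), e2]
      have h5 : 0 ≤ (a ^ 2) ^ (α / 2) := by positivity
      calc (a ^ 2) ^ (α / 2) * (1 + b ^ 2 / a ^ 2) ^ (α / 2)
          ≤ (a ^ 2) ^ (α / 2) * (1 + α / 2 * (b ^ 2 / a ^ 2) ^ (α / 2)) := by
            gcongr
            exact h3.trans (by gcongr)
        _ = _ := by ring
  simp only [hsq]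
  linarith

/-! ### Covariances of mixtures -/

section Covariance

variable {Ω : Type*} [MeasurableSpace Ω] {P : Measure Ω} [IsProbabilityMeasure P]

lemma memLp_two_of_abs_le_one {A : Ω → ℝ} (hA : Measurable A) (hb : ∀ ω, |A ω| ≤ 1) :
    MemLp A 2 P :=
  MemLp.of_bound hA.aestronglyMeasurable 1 (Eventually.of_forall hb)

/-- Centring only one factor makes the covariance a single integral linear in the other, ready for
Fubini. -/
lemma covariance_eq_integral_mul_centered {A Z : Ω → ℝ} (hA : MemLp A 2 P) (hZ : MemLp Z 2 P) :
    cov[A, Z; P] = ∫ ω, A ω * (Z ω - ∫ ω', Z ω' ∂P) ∂P := by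
  have hZi : Integrable Z P := hZ.integrable (by norm_num)
  rw [← covariance_sub_const_right hZi (∫ ω', Z ω' ∂P)]
  refine (covariance_eq_sub hA (hZ.sub (memLp_const _))).trans ?_
  have h0 : ∫ ω, (Z - fun _ => ∫ ω', Z ω' ∂P : Ω → ℝ) ω ∂P = 0 := by
    simp only [Pi.sub_apply]
    rw [integral_sub hZi (integrable_const _)]
    simp
  rw [h0, mul_zero, sub_zero]
  rfl

variable {S : Type*} [MeasurableSpace S] {ν : Measure S} [IsFiniteMeasure ν]

lemma covariance_integral_left {φ : S → Ω → ℝ} (hφ : Measurable (Function.uncurry φ))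
    (hφb : ∀ s ω, |φ s ω| ≤ 1) {Z : Ω → ℝ} {C : ℝ} (hZ : Measurable Z) (hZb : ∀ ω, |Z ω| ≤ C) :
    Integrable (fun s => cov[φ s, Z; P]) ν ∧
      ∫ s, cov[φ s, Z; P] ∂ν = cov[fun ω => ∫ s, φ s ω ∂ν, Z; P] := by
  have hZ2 : MemLp Z 2 P := MemLp.of_bound hZ.aestronglyMeasurable C (Eventually.of_forall hZb)
  have hφs : ∀ s, Measurable (φ s) := fun s => hφ.comp measurable_prodMk_left
  set W : Ω → ℝ := fun ω => Z ω - ∫ ω', Z ω' ∂P with hW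
  have hWm : Measurable W := hZ.sub_const _
  have hWb : ∀ ω, |W ω| ≤ C + |∫ ω', Z ω' ∂P| := fun ω =>
    (abs_sub _ _).trans (by have := hZb ω; gcongr)
  have hG : MemLp (fun ω => ∫ s, φ s ω ∂ν) 2 P := by
    refine MemLp.of_bound ?_ (1 * ν.real Set.univ) (Eventually.of_forall fun ω =>
      norm_integral_le_of_norm_le_const (Eventually.of_forall fun s => hφb s ω))
    exact (hφ.stronglyMeasurable.integral_prod_left (μ := ν)).aestronglyMeasurable
  have hint : Integrable (Function.uncurry fun s ω => φ s ω * W ω) (ν.prod P) := by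
    refine Integrable.of_bound (C := 1 * (C + |∫ ω', Z ω' ∂P|))
      (hφ.mul (hWm.comp measurable_snd)).aestronglyMeasurable (Eventually.of_forall fun p => ?_)
    rw [Function.uncurry_def, norm_mul]
    exact mul_le_mul (hφb _ _) (hWb _) (norm_nonneg _) zero_le_one
  have e : ∀ s, cov[φ s, Z; P] = ∫ ω, φ s ω * W ω ∂P := fun s =>
    covariance_eq_integral_mul_centered (memLp_two_of_abs_le_one (hφs s) (hφb s)) hZ2
  simp_rw [e]
  refine ⟨hint.integral_prod_left, ?_⟩
  rw [covariance_eq_integral_mul_centered hG hZ2, integral_integral_swap hint]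
  refine integral_congr_ae (Eventually.of_forall fun ω => ?_)
  simp only [integral_mul_const, hW]

/-- Covariances of mixtures are mixtures of covariances. -/
lemma integral_integral_covariance {φ : S → ℝ → ℝ} (hφ : Measurable (Function.uncurry φ))
    (hφb : ∀ s x, |φ s x| ≤ 1) {X Y : Ω → ℝ} (hX : Measurable X) (hY : Measurable Y) :
    (∀ v, Integrable (fun u => cov[fun ω => φ u (X ω), fun ω => φ v (Y ω); P]) ν) ∧
    Integrable (fun v => ∫ u, cov[fun ω => φ u (X ω), fun ω => φ v (Y ω); P] ∂ν) ν ∧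
    ∫ v, ∫ u, cov[fun ω => φ u (X ω), fun ω => φ v (Y ω); P] ∂ν ∂ν =
      cov[fun ω => ∫ u, φ u (X ω) ∂ν, fun ω => ∫ v, φ v (Y ω) ∂ν; P] := by
  have hφs : ∀ s, Measurable (φ s) := fun s => hφ.comp measurable_prodMk_left
  have hφX : Measurable (Function.uncurry fun s ω => φ s (X ω)) :=
    hφ.comp (measurable_fst.prodMk (hX.comp measurable_snd))
  have hφY : Measurable (Function.uncurry fun s ω => φ s (Y ω)) :=
    hφ.comp (measurable_fst.prodMk (hY.comp measurable_snd))
  have h1 := fun v => covariance_integral_left (P := P) (ν := ν) hφX (fun s ω => hφb s (X ω))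
    ((hφs v).comp hY) (fun ω => hφb v (Y ω))
  have hG : Measurable fun ω => ∫ u, φ u (X ω) ∂ν :=
    (hφX.stronglyMeasurable.integral_prod_left (μ := ν)).measurable
  have hGb : ∀ ω, |∫ u, φ u (X ω) ∂ν| ≤ 1 * ν.real Set.univ := fun ω => by
    rw [← Real.norm_eq_abs]
    exact norm_integral_le_of_norm_le_const (Eventually.of_forall fun s => hφb s (X ω))
  have h2 := covariance_integral_left (P := P) (ν := ν) hφY (fun s ω => hφb s (Y ω)) hG hGb
  have e : ∀ v, ∫ u, cov[fun ω => φ u (X ω), fun ω => φ v (Y ω); P] ∂ν =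
      cov[fun ω => φ v (Y ω), fun ω => ∫ u, φ u (X ω) ∂ν; P] := fun v => by
    rw [covariance_comm]
    exact (h1 v).2
  refine ⟨fun v => (h1 v).1, ?_, ?_⟩
  · simp_rw [e]
    exact h2.1
  · simp_rw [e]
    rw [h2.2, covariance_comm]

end Covariance

/-! ### Two representations of `1 / (1 + x ^ 2)` -/

/-- The measure with density `1 / (1 + u ^ 2)`. -/
noncomputable def cauchyDensityMeasure : Measure ℝ :=
  volume.withDensity fun u => ENNReal.ofReal ((1 + u ^ 2)⁻¹)

instance : IsFiniteMeasure cauchyDensityMeasure :=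
  isFiniteMeasure_withDensity_ofReal integrable_inv_one_add_sq.2

/-- The measure on `(0, ∞)` with density `exp (-s)`. -/
noncomputable def expDensityMeasure : Measure ℝ :=
  (volume.restrict (Set.Ioi 0)).withDensity fun s => ENNReal.ofReal (Real.exp (-s))

instance : IsFiniteMeasure expDensityMeasure :=
  isFiniteMeasure_withDensity_ofReal (integrableOn_exp_neg_Ioi 0).2

lemma abs_two_mul_div_one_add_sq_le (u : ℝ) : |-2 * u / (1 + u ^ 2)| ≤ 1 := by
  rw [abs_div, abs_of_pos (by positivity : 0 < 1 + u ^ 2), div_le_one (by positivity), abs_le]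
  constructor <;> nlinarith [sq_nonneg (u - 1), sq_nonneg (u + 1)]

/-- Weight times density is the derivative of `(1 + u ^ 2)⁻¹`, which vanishes at `-∞`. -/
lemma integral_cauchyDensityMeasure (x : ℝ) :
    ∫ u, -2 * u / (1 + u ^ 2) * (Set.Iio x).indicator 1 u ∂cauchyDensityMeasure =
      (1 + x ^ 2)⁻¹ := by
  have hpos : ∀ u : ℝ, 0 < 1 + u ^ 2 := fun u => by positivity
  have hint : Integrable fun u : ℝ => -2 * u / (1 + u ^ 2) ^ 2 := by
    refine integrable_inv_one_add_sq.mono (Measurable.aestronglyMeasurable (by fun_prop)) (Eventually.of_forall fun u => ?_)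
    have e : -2 * u / (1 + u ^ 2) ^ 2 = -2 * u / (1 + u ^ 2) * (1 + u ^ 2)⁻¹ := by
      have := (hpos u).ne'
      field_simp
    rw [e, norm_mul]
    exact mul_le_of_le_one_left (norm_nonneg _) (abs_two_mul_div_one_add_sq_le u)
  have hderiv : ∀ u ∈ Set.Iic x, HasDerivAt (fun u : ℝ => (1 + u ^ 2)⁻¹)
      (-2 * u / (1 + u ^ 2) ^ 2) u := fun u _ => by
    have := (((hasDerivAt_id' u).fun_pow 2).const_add 1).fun_inv (hpos u).ne'
    exact this.congr_deriv (by norm_num)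
  have hlim : Tendsto (fun u : ℝ => (1 + u ^ 2)⁻¹) atBot (𝓝 0) := by
    refine tendsto_inv_atTop_zero.comp (tendsto_atTop_add_const_left _ _ ?_)
    exact (tendsto_pow_atTop two_ne_zero).comp tendsto_abs_atBot_atTop |>.congr fun u => sq_abs u
  rw [cauchyDensityMeasure, integral_withDensity_eq_integral_toReal_smul (by fun_prop)
    (Eventually.of_forall fun _ => ENNReal.ofReal_lt_top)]
  have e : ∀ u : ℝ, (ENNReal.ofReal ((1 + u ^ 2)⁻¹)).toReal •
      (-2 * u / (1 + u ^ 2) * (Set.Iio x).indicator 1 u) =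
      (Set.Iio x).indicator (fun u => -2 * u / (1 + u ^ 2) ^ 2) u := fun u => by
    have := (hpos u).ne'
    rw [ENNReal.toReal_ofReal (inv_nonneg.2 (hpos u).le), smul_eq_mul]
    by_cases h : u ∈ Set.Iio x
    · simp only [Set.indicator_of_mem h, Pi.one_apply]
      field_simp
    · simp [Set.indicator_of_notMem h]
  simp_rw [e]
  rw [integral_indicator measurableSet_Iio, ← integral_Iic_eq_integral_Iio,
    integral_Iic_of_hasDerivAt_of_tendsto' hderiv hint.integrableOn hlim, sub_zero]

/-- This is the real part of `∫ exp ((-1 + i x) s) ds = 1 / (1 - i x)` over `(0, ∞)`. -/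
lemma integral_expDensityMeasure_cos (x : ℝ) :
    ∫ s, Real.cos (s * x) ∂expDensityMeasure = (1 + x ^ 2)⁻¹ := by
  rw [expDensityMeasure, integral_withDensity_eq_integral_toReal_smul (by fun_prop)
    (Eventually.of_forall fun _ => ENNReal.ofReal_lt_top)]
  have h := integral_exp_mul_complex_Ioi (a := -1 + x * Complex.I) (by simp) 0
  have h2 := congrArg Complex.re h
  have hi : Integrable (fun s : ℝ => Complex.exp ((-1 + x * Complex.I) * s))
      (volume.restrict (Set.Ioi 0)) :=
    integrableOn_exp_mul_complex_Ioi (by simp) 0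
  rw [← RCLike.re_eq_complex_re, ← integral_re hi] at h2
  have e : ∀ s : ℝ, (ENNReal.ofReal (Real.exp (-s))).toReal • Real.cos (s * x) =
      RCLike.re (Complex.exp ((-1 + x * Complex.I) * s)) := fun s => by
    rw [ENNReal.toReal_ofReal (Real.exp_pos _).le, RCLike.re_eq_complex_re, Complex.exp_re]
    simp [mul_comm]
  simp_rw [e]
  rw [h2]
  simp [Complex.div_re, Complex.normSq_apply]
  field_simp

lemma expDensityMeasure_Icc_pos : 0 < expDensityMeasure.real (Set.Icc 1 2) := by
  rw [Measure.real, ENNReal.toReal_pos_iff]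
  refine ⟨?_, measure_lt_top _ _⟩
  rw [expDensityMeasure, withDensity_apply _ measurableSet_Icc,
    Measure.restrict_restrict measurableSet_Icc,
    Set.inter_eq_left.2 fun s hs => Set.mem_Ioi.2 (one_pos.trans_le hs.1)]
  rw [setLIntegral_pos_iff (by fun_prop)]
  have : (Function.support fun s : ℝ => ENNReal.ofReal (Real.exp (-s))) = Set.univ := by
    ext s; simp [Real.exp_pos]
  simp [this]

/-! ### From cosine covariances to excursion covariances -/

section Excursion

variable {Ω : Type*} [MeasurableSpace Ω] {P : Measure Ω} [IsProbabilityMeasure P]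

lemma integral_integral_covariance_cos_le {X : ℝ → Ω → ℝ} (hX : ∀ t, Measurable (X t)) (t : ℝ) :
    ENNReal.ofReal (∫ v, ∫ u, cov[fun ω => Real.cos (u * X 0 ω), fun ω => Real.cos (v * X t ω); P]
        ∂expDensityMeasure ∂expDensityMeasure) ≤
      ∫⁻ v, ∫⁻ u, ENNReal.ofReal |excursionCov P X t u v|
        ∂cauchyDensityMeasure ∂cauchyDensityMeasure := by
  have h1 := (integral_integral_covariance (P := P) (ν := expDensityMeasure)
    (φ := fun s x => Real.cos (s * x)) (by fun_prop) (fun s x => Real.abs_cos_le_one _)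
    (hX 0) (hX t)).2.2
  have hm : Measurable (Function.uncurry fun u x : ℝ =>
      -2 * u / (1 + u ^ 2) * (Set.Iio x).indicator 1 u) := by
    have : (Function.uncurry fun u x : ℝ => -2 * u / (1 + u ^ 2) * (Set.Iio x).indicator 1 u) =
        fun p => -2 * p.1 / (1 + p.1 ^ 2) * {p : ℝ × ℝ | p.1 < p.2}.indicator 1 p := by
      ext p; simp [Function.uncurry_def, Set.indicator]
    rw [this]
    exact Measurable.mul (by fun_prop)
      (measurable_one.indicator (measurableSet_lt measurable_fst measurable_snd))
  have h2 := (integral_integral_covariance (P := P) (ν := cauchyDensityMeasure)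
    (φ := fun u x => -2 * u / (1 + u ^ 2) * (Set.Iio x).indicator 1 u) hm (fun u x => by
      rw [abs_mul]
      refine mul_le_one₀ (abs_two_mul_div_one_add_sq_le u) (abs_nonneg _) ?_
      by_cases h : u ∈ Set.Iio x
      · simp [Set.indicator_of_mem h]
      · simp [Set.indicator_of_notMem h])
    (hX 0) (hX t)).2.2
  simp_rw [integral_expDensityMeasure_cos] at h1
  simp_rw [integral_cauchyDensityMeasure] at h2
  -- Both mixtures compute the covariance of `(1 + X 0 ^ 2)⁻¹` and `(1 + X t ^ 2)⁻¹`.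
  rw [h1, ← h2]
  have hind : ∀ (r u : ℝ), (fun ω => -2 * u / (1 + u ^ 2) * (Set.Iio (X r ω)).indicator 1 u) =
      fun ω => -2 * u / (1 + u ^ 2) * {ω | u < X r ω}.indicator (fun _ => (1 : ℝ)) ω := by
    intro r u
    ext ω
    simp [Set.indicator]
  have e : ∀ u v, cov[fun ω => -2 * u / (1 + u ^ 2) * (Set.Iio (X 0 ω)).indicator 1 u,
      fun ω => -2 * v / (1 + v ^ 2) * (Set.Iio (X t ω)).indicator 1 v; P] =
      -2 * u / (1 + u ^ 2) * (-2 * v / (1 + v ^ 2) * excursionCov P X t u v) := fun u v => by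
    rw [hind, hind, covariance_const_mul_left, covariance_const_mul_right]
    rfl
  simp_rw [e]
  refine (ENNReal.ofReal_le_ofReal (le_abs_self _)).trans ?_
  rw [← Real.enorm_eq_ofReal_abs]
  refine (enorm_integral_le_lintegral_enorm _).trans (lintegral_mono fun v => ?_)
  refine (enorm_integral_le_lintegral_enorm _).trans (lintegral_mono fun u => ?_)
  rw [Real.enorm_eq_ofReal_abs]
  refine ENNReal.ofReal_le_ofReal ?_
  rw [abs_mul, abs_mul]
  exact (mul_le_of_le_one_left (by positivity) (abs_two_mul_div_one_add_sq_le u)).trans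
    (mul_le_of_le_one_left (abs_nonneg _) (abs_two_mul_div_one_add_sq_le v))

end Excursion

/-! ### Lower bounds for cosine covariances, and divergence -/

section MovingAverage

variable {Ω : Type*} [MeasurableSpace Ω] {P : Measure Ω} {α : ℝ}

lemma integrable_abs_rpow (hα : 0 < α) {f : ℝ → ℝ} (hf : MemLp f (ENNReal.ofReal α) volume) :
    Integrable fun x => |f x| ^ α := by
  have := hf.integrable_norm_rpow (by simpa using hα) ENNReal.ofReal_ne_top
  simpa [ENNReal.toReal_ofReal hα.le] using this

lemma toReal_lintegral_enorm_rpow (hα : 0 < α) {f : ℝ → ℝ} (hf : Measurable f) :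
    (∫⁻ x, ‖f x‖ₑ ^ α).toReal = ∫ x, |f x| ^ α := by
  rw [integral_eq_lintegral_of_nonneg_ae
    (Eventually.of_forall fun x => Real.rpow_nonneg (abs_nonneg _) _)
    (Measurable.aestronglyMeasurable (by fun_prop))]
  congr 1
  refine lintegral_congr fun x => ?_
  rw [Real.enorm_eq_ofReal_abs, ENNReal.ofReal_rpow_of_nonneg (abs_nonneg _) hα.le]

variable [IsProbabilityMeasure P]

lemma le_covariance_cos {Λ : Set ℝ → Ω → ℝ} (hα0 : 0 < α) (hα2 : α < 2)
    (hΛ : IsSaSRandomMeasure P α Λ) {f g : ℝ → ℝ} {Y Z : Ω → ℝ}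
    (hf : Measurable f) (hfp : MemLp f (ENNReal.ofReal α) volume)
    (hg : Measurable g) (hgp : MemLp g (ENNReal.ofReal α) volume)
    (hYm : Measurable Y) (hZm : Measurable Z)
    (hY : IsAEStableIntegral P α Λ f Y) (hZ : IsAEStableIntegral P α Λ g Z) :
    Real.exp (-((∫ x, |f x| ^ α) + ∫ x, |g x| ^ α)) *
        ((2 - α) / 2 * ∫ x, min (|f x| ^ α) (|g x| ^ α)) ≤
      cov[fun ω => Real.cos (Y ω), fun ω => Real.cos (Z ω); P] := by
  have hs : MemLp (fun x => f x + g x) (ENNReal.ofReal α) volume := hfp.add hgp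
  have hd : MemLp (fun x => f x - g x) (ENNReal.ofReal α) volume := hfp.sub hgp
  have hYZ := hY.add hΛ hf hg hZ
  have hYZ' : IsAEStableIntegral P α Λ (fun x => f x - g x) (fun ω => Y ω - Z ω) := by
    simpa [sub_eq_add_neg] using hY.add hΛ hf (hg.const_mul (-1)) (hZ.const_mul hΛ (-1))
  have cY := hY.integral_cos hα0 hΛ hf hfp hYm
  have cZ := hZ.integral_cos hα0 hΛ hg hgp hZm
  have msum : Measurable fun ω => Y ω + Z ω := hYm.add hZm
  have mdiff : Measurable fun ω => Y ω - Z ω := hYm.sub hZm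
  have cs := hYZ.integral_cos hα0 hΛ (by fun_prop) hs msum
  have cd := hYZ'.integral_cos hα0 hΛ (by fun_prop) hd mdiff
  rw [toReal_lintegral_enorm_rpow hα0 (by fun_prop)] at cY cZ cs cd
  have hcos : ∀ {W : Ω → ℝ}, Measurable W → Integrable (fun ω => Real.cos (W ω)) P := fun hW =>
    Integrable.of_bound (C := 1) (Measurable.aestronglyMeasurable (by fun_prop))
      (Eventually.of_forall fun ω => Real.abs_cos_le_one _)
  have hprod : ∫ ω, Real.cos (Y ω) * Real.cos (Z ω) ∂P =
      ((∫ ω, Real.cos (Y ω + Z ω) ∂P) + ∫ ω, Real.cos (Y ω - Z ω) ∂P) / 2 := by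
    rw [← integral_add (hcos msum) (hcos mdiff), ← integral_div]
    refine integral_congr_ae (Eventually.of_forall fun ω => ?_)
    simp only [Real.cos_add, Real.cos_sub]
    ring
  have hcov : cov[fun ω => Real.cos (Y ω), fun ω => Real.cos (Z ω); P] =
      (Real.exp (-∫ x, |f x + g x| ^ α) + Real.exp (-∫ x, |f x - g x| ^ α)) / 2 -
        Real.exp (-((∫ x, |f x| ^ α) + ∫ x, |g x| ^ α)) := by
    rw [covariance_eq_sub (memLp_two_of_abs_le_one (by fun_prop) fun _ => Real.abs_cos_le_one _)
      (memLp_two_of_abs_le_one (by fun_prop) fun _ => Real.abs_cos_le_one _)]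
    simp only [Pi.mul_apply]
    rw [hprod, cY, cZ, cs, cd, neg_add, Real.exp_add]
  have If := integrable_abs_rpow hα0 hfp
  have Ig := integrable_abs_rpow hα0 hgp
  have Is := integrable_abs_rpow hα0 hs
  have Id := integrable_abs_rpow hα0 hd
  have Im : Integrable fun x => min (|f x| ^ α) (|g x| ^ α) := If.inf Ig
  have Isd : Integrable fun x => |f x + g x| ^ α + |f x - g x| ^ α := Is.add Id
  have key : (∫ x, |f x + g x| ^ α) + (∫ x, |f x - g x| ^ α) +
      (2 - α) * ∫ x, min (|f x| ^ α) (|g x| ^ α) ≤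
      2 * ((∫ x, |f x| ^ α) + ∫ x, |g x| ^ α) := by
    rw [← integral_add Is Id, ← integral_const_mul, ← integral_add Isd (Im.const_mul _),
      ← integral_add If Ig, ← integral_const_mul]
    exact integral_mono (Isd.add (Im.const_mul _)) ((If.add Ig).const_mul 2)
      fun x => rpow_abs_add_add_rpow_abs_sub_le hα0 hα2 (f x) (g x)
  rw [hcov]
  set A := ∫ x, |f x + g x| ^ α
  set B := ∫ x, |f x - g x| ^ α
  set C := (∫ x, |f x| ^ α) + ∫ x, |g x| ^ α
  -- The graph of `a ↦ exp (-a)` lies above its tangent at `C`; averaging over `a = A` and `a = B`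
  -- bounds the covariance below by `exp (-C) * (C - (A + B) / 2)`.
  have hexp : ∀ a, Real.exp (-C) * (1 + (C - a)) ≤ Real.exp (-a) := fun a => by
    have e : Real.exp (-a) = Real.exp (-C) * Real.exp (C - a) := by
      rw [← Real.exp_add]; congr 1; ring
    rw [e]
    gcongr
    linarith [Real.add_one_le_exp (C - a)]
  have h1 : Real.exp (-C) * ((2 - α) / 2 * ∫ x, min (|f x| ^ α) (|g x| ^ α)) ≤
      Real.exp (-C) * (C - (A + B) / 2) := by
    gcongr
    linarith
  linarith [hexp A, hexp B]

lemma le_covariance_cos_movingAverage (hα0 : 0 < α) (hα2 : α < 2) {m : ℝ → ℝ}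
    (hm : ∀ x, 0 ≤ m x) {X : ℝ → Ω → ℝ} (hX : IsSaSMovingAverage P α m X) (t u v : ℝ) :
    0 ≤ cov[fun ω => Real.cos (u * X 0 ω), fun ω => Real.cos (v * X t ω); P] ∧
    (u ∈ Set.Icc 1 2 → v ∈ Set.Icc 1 2 →
      Real.exp (-(8 * ∫ x, m x ^ α)) *
        ((2 - α) / 2 * ∫ x, min (m (0 - x) ^ α) (m (t - x) ^ α)) ≤
      cov[fun ω => Real.cos (u * X 0 ω), fun ω => Real.cos (v * X t ω); P]) := by
  obtain ⟨Λ, hΛ, hI⟩ := hX.exists_integral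
  have hmm := hX.measurable_kernel
  have hXm := hX.measurable
  have hmp : ∀ r, MemLp (fun x => m (r - x)) (ENNReal.ofReal α) volume := fun r =>
    hX.memLp_kernel.comp_measurePreserving (Measure.measurePreserving_sub_left volume r)
  have h := le_covariance_cos hα0 hα2 hΛ (f := fun x => u * m (0 - x))
    (g := fun x => v * m (t - x)) (by fun_prop) ((hmp 0).const_mul u) (by fun_prop)
    ((hmp t).const_mul v) ((hXm 0).const_mul u) ((hXm t).const_mul v)
    ((hI 0).isAEStableIntegral.const_mul hΛ u) ((hI t).isAEStableIntegral.const_mul hΛ v)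
  have h2α : 0 ≤ (2 - α) / 2 := by linarith
  refine ⟨le_trans ?_ h, fun hu hv => le_trans ?_ h⟩
  · exact mul_nonneg (Real.exp_pos _).le (mul_nonneg h2α
      (integral_nonneg fun x => le_min (by positivity) (by positivity)))
  have hJ0 : 0 ≤ ∫ x, m x ^ α := integral_nonneg fun x => Real.rpow_nonneg (hm x) α
  -- Frequencies at most 2 contribute `s ^ α ≤ 4` each, whence the 8 in the exponent; frequencies at
  -- least 1 do not decrease the minimum.
  have hJ : ∀ s ∈ Set.Icc (1 : ℝ) 2, ∀ r, ∫ x, |s * m (r - x)| ^ α ≤ 4 * ∫ x, m x ^ α := by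
    intro s hs r
    have hs0 : 0 ≤ s := zero_le_one.trans hs.1
    have e : ∀ x, |s * m (r - x)| ^ α = s ^ α * m (r - x) ^ α := fun x => by
      rw [abs_of_nonneg (mul_nonneg hs0 (hm _)), Real.mul_rpow hs0 (hm _)]
    simp_rw [e]
    rw [integral_const_mul, integral_sub_left_eq_self (fun x => m x ^ α) volume r]
    gcongr
    calc s ^ α ≤ 2 ^ α := Real.rpow_le_rpow hs0 hs.2 hα0.le
      _ ≤ 2 ^ (2 : ℝ) := Real.rpow_le_rpow_of_exponent_le one_le_two hα2.le
      _ = 4 := by norm_num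
  have hle : ∀ s ∈ Set.Icc (1 : ℝ) 2, ∀ r x, m (r - x) ^ α ≤ |s * m (r - x)| ^ α := by
    intro s hs r x
    refine Real.rpow_le_rpow (hm _) ?_ hα0.le
    exact (le_mul_of_one_le_left (hm _) hs.1).trans (le_abs_self _)
  have hmin : ∫ x, min (m (0 - x) ^ α) (m (t - x) ^ α) ≤
      ∫ x, min (|u * m (0 - x)| ^ α) (|v * m (t - x)| ^ α) := by
    refine integral_mono_of_nonneg
      (Eventually.of_forall fun x => le_min (Real.rpow_nonneg (hm _) _) (Real.rpow_nonneg (hm _) _))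
      ((integrable_abs_rpow hα0 ((hmp 0).const_mul u)).inf
        (integrable_abs_rpow hα0 ((hmp t).const_mul v)))
      (Eventually.of_forall fun x => min_le_min (hle u hu 0 x) (hle v hv t x))
  have hmin0 : 0 ≤ ∫ x, min (m (0 - x) ^ α) (m (t - x) ^ α) :=
    integral_nonneg fun x => le_min (Real.rpow_nonneg (hm _) _) (Real.rpow_nonneg (hm _) _)
  gcongr
  linarith [hJ u hu 0, hJ v hv t]

/-- Nonnegativity everywhere allows all frequencies outside `[1, 2] × [1, 2]` to be discarded. -/
lemma le_integral_integral_covariance_cos {X Y : Ω → ℝ} (hX : Measurable X) (hY : Measurable Y)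
    {κ : ℝ}
    (h0 : ∀ u v, 0 ≤ cov[fun ω => Real.cos (u * X ω), fun ω => Real.cos (v * Y ω); P])
    (h1 : ∀ u ∈ Set.Icc (1 : ℝ) 2, ∀ v ∈ Set.Icc (1 : ℝ) 2,
      κ ≤ cov[fun ω => Real.cos (u * X ω), fun ω => Real.cos (v * Y ω); P]) :
    κ * expDensityMeasure.real (Set.Icc 1 2) ^ 2 ≤
      ∫ v, ∫ u, cov[fun ω => Real.cos (u * X ω), fun ω => Real.cos (v * Y ω); P]
        ∂expDensityMeasure ∂expDensityMeasure := by
  obtain ⟨i1, i2, -⟩ := integral_integral_covariance (P := P) (ν := expDensityMeasure)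
    (φ := fun s x => Real.cos (s * x)) (by fun_prop) (fun s x => Real.abs_cos_le_one _) hX hY
  have hset : ∀ {F : ℝ → ℝ} {c : ℝ}, Integrable F expDensityMeasure → (∀ s, 0 ≤ F s) →
      (∀ s ∈ Set.Icc (1 : ℝ) 2, c ≤ F s) →
      c * expDensityMeasure.real (Set.Icc 1 2) ≤ ∫ s, F s ∂expDensityMeasure := by
    intro F c hF hF0 hFc
    calc c * expDensityMeasure.real (Set.Icc 1 2)
        = ∫ s in Set.Icc (1 : ℝ) 2, c ∂expDensityMeasure := by simp [mul_comm]
      _ ≤ ∫ s in Set.Icc (1 : ℝ) 2, F s ∂expDensityMeasure :=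
          setIntegral_mono_on (integrable_const _) hF.integrableOn measurableSet_Icc hFc
      _ ≤ _ := setIntegral_le_integral hF (Eventually.of_forall hF0)
  rw [sq, ← mul_assoc]
  exact hset i2 (fun v => integral_nonneg fun u => h0 u v)
    fun v hv => hset (i1 v) (fun u => h0 u v) fun u hu => h1 u hu v hv

/-- After Tonelli, for fixed `x` a shift of `t` decouples the two arguments; the reflection `x ↦ 0 -
x` does the rest. -/
lemma lintegral_lintegral_min_sub {F : ℝ → ENNReal} (hF : Measurable F) :
    ∫⁻ t, ∫⁻ x, min (F (0 - x)) (F (t - x)) = ∫⁻ t, ∫⁻ x, min (F x) (F t) := by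
  rw [lintegral_lintegral_swap (by fun_prop)]
  have e : ∀ x, ∫⁻ t, min (F (0 - x)) (F (t - x)) = ∫⁻ t, min (F (0 - x)) (F t) := fun x =>
    lintegral_sub_right_eq_self (fun t => min (F (0 - x)) (F t)) x
  simp_rw [e]
  rw [lintegral_sub_left_eq_self (fun x => ∫⁻ t, min (F x) (F t)) 0]
  simp_rw [fun x t => min_comm (F x) (F t)]

end MovingAverage

theorem mainTheorem3 {Ω : Type*} [MeasurableSpace Ω] (P : Measure Ω) [IsProbabilityMeasure P]
    (α : ℝ) (hα0 : 0 < α) (hα2 : α < 2)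
    (m : ℝ → ℝ) (hm : ∀ x, 0 ≤ m x)
    (X : ℝ → Ω → ℝ) (hX : IsSaSMovingAverage P α m X)
    (hmin : ∫⁻ t : ℝ, ∫⁻ x : ℝ, ENNReal.ofReal (min (m x ^ α) (m t ^ α)) = ⊤) :
    IsLongRangeDependent P X := by
  refine ⟨hX.isStationaryProcess hα0, cauchyDensityMeasure, inferInstance, ?_⟩
  have hmm := hX.measurable_kernel
  have hXm := hX.measurable
  have hD : ∀ t, ENNReal.ofReal (∫ x, min (m (0 - x) ^ α) (m (t - x) ^ α)) =
      ∫⁻ x, min (ENNReal.ofReal (m (0 - x) ^ α)) (ENNReal.ofReal (m (t - x) ^ α)) := by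
    intro t
    have hi : ∀ r, Integrable fun x => m (r - x) ^ α := fun r => by
      have := integrable_abs_rpow hα0 (hX.memLp_kernel.comp_measurePreserving
        (Measure.measurePreserving_sub_left volume r))
      simpa [abs_of_nonneg (hm _)] using this
    have hi' : Integrable fun x => min (m (0 - x) ^ α) (m (t - x) ^ α) := (hi 0).inf (hi t)
    rw [ofReal_integral_eq_lintegral_ofReal hi'
      (Eventually.of_forall fun x => le_min (Real.rpow_nonneg (hm _) _) (Real.rpow_nonneg (hm _) _))]
    simp_rw [ENNReal.ofReal_min]
  have hdiv : ∫⁻ t, ENNReal.ofReal (∫ x, min (m (0 - x) ^ α) (m (t - x) ^ α)) = ⊤ := by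
    simp_rw [hD]
    rw [lintegral_lintegral_min_sub (F := fun x => ENNReal.ofReal (m x ^ α)) (by fun_prop), ← hmin]
    simp_rw [ENNReal.ofReal_min]
  -- Uniform in `t`: the covariance bound on `[1, 2] × [1, 2]` times the squared mass of `[1, 2]`.
  set c : ℝ := Real.exp (-(8 * ∫ x, m x ^ α)) * ((2 - α) / 2) *
    expDensityMeasure.real (Set.Icc 1 2) ^ 2 with hc
  have hc0 : 0 < c := mul_pos (mul_pos (Real.exp_pos _) (by linarith))
    (pow_pos expDensityMeasure_Icc_pos 2)
  rw [eq_top_iff]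
  calc (⊤ : ENNReal)
      = ENNReal.ofReal c * ∫⁻ t, ENNReal.ofReal (∫ x, min (m (0 - x) ^ α) (m (t - x) ^ α)) := by
        rw [hdiv, ENNReal.mul_top (by simpa using hc0)]
    _ = ∫⁻ t, ENNReal.ofReal c *
          ENNReal.ofReal (∫ x, min (m (0 - x) ^ α) (m (t - x) ^ α)) :=
        (lintegral_const_mul' _ _ ENNReal.ofReal_ne_top).symm
    _ ≤ _ := lintegral_mono fun t => ?_
  rw [← ENNReal.ofReal_mul hc0.le]
  refine (ENNReal.ofReal_le_ofReal ?_).trans (integral_integral_covariance_cos_le hXm t)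
  have h := le_covariance_cos_movingAverage hα0 hα2 hm hX t
  refine le_trans (le_of_eq ?_) (le_integral_integral_covariance_cos (hXm 0) (hXm t)
    (fun u v => (h u v).1) fun u hu v hv => (h u v).2 hu hv)
  rw [hc]
  ring
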